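/- Let $\mathcal N\subset\mathbb R^j$ be an (embedded, not necessarily closed) $C^2$ submanifold without boundary, let $d(x,\mathcal N)=\inf_{y\in\mathcal N}\|x-y\|$ be the Euclidean distance, and let $\mathcal U$ be the largest open subset of $\mathbb R^j$ such that every $x\in\mathcal U$ has a unique closest point in $\mathcal N$. Then $\alpha(x)=1/d(x,\mathcal N)^{2}$ is self-convex on $\mathcal U\setminus\mathcal N$. That is: $\mathcal U\setminus\mathcal N$ is open, $\alpha$ is of class $C^2$ and positive on it, and for every geodesic $\gamma:I\to\mathcal U\setminus\mathcal N$ ($I\subset\mathbb R$ an interval) of the Riemannian metric $\langle\cdot,\cdot\rangle_{\kappa,x}=\alpha(x)\langle\cdot,\cdot\rangle$ on $\mathcal U\setminus\mathcal N$, where $\langle\cdot,\cdot\rangle$ is the Euclidean inner product, the function $t\mapsto\log\alpha(\gamma(t))$ is convex on $I$. Here a geodesic is a solution of the geodesic equation $\nabla_{\dot\gamma}\dot\gamma=0$ for the Levi-Civita connection of this metric (not necessarily minimizing). -/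

import Mathlib

/-- `N` is an (embedded) `C²` submanifold without boundary of `E`, not necessarily closed: around
each of its points a local `C²` diffeomorphism `Φ` of `E` straightens `N` onto a linear subspace.
The dimension of `V` may depend on the point, so submanifolds of constant dimension and disjoint
unions of components of different dimensions are all covered. -/
def IsC2Submanifold {E : Type*} [NormedAddCommGroup E] [NormedSpace ℝ E] (N : Set E) : Prop :=
  ∀ p ∈ N, ∃ (Φ : OpenPartialHomeomorph E E) (V : Submodule ℝ E),
    p ∈ Φ.source ∧
    ContDiffOn ℝ 2 Φ Φ.source ∧
    ContDiffOn ℝ 2 Φ.symm Φ.target ∧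
    Φ '' (Φ.source ∩ N) = Φ.target ∩ (V : Set E)

/-- `y` is a closest point of `N` to `x`. -/
def IsClosestPoint {E : Type*} [PseudoMetricSpace E] (N : Set E) (x y : E) : Prop :=
  y ∈ N ∧ ∀ z ∈ N, dist x y ≤ dist x z

/-- The largest open set all of whose points have a unique closest point in `N`. -/
def uniqueClosestRegion {E : Type*} [PseudoMetricSpace E] (N : Set E) : Set E :=
  interior {x | ∃! y, IsClosestPoint N x y}

section Riemannian

variable {E : Type*} [NormedAddCommGroup E] [InnerProductSpace ℝ E]

/-- The Christoffel symbols of the first kind, `Γ(u, v; w) = ⟨∇_u v, w⟩` for constant vector fields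
`u`, `v`, `w`, of the Levi-Civita connection of a Riemannian metric `g` on an open subset of `E`. -/
noncomputable def christoffelFirst (g : E → E →ₗ[ℝ] E →ₗ[ℝ] ℝ) (x u v w : E) : ℝ :=
  (fderiv ℝ (fun y => g y v w) x u + fderiv ℝ (fun y => g y u w) x v
    - fderiv ℝ (fun y => g y u v) x w) / 2

/-- `γ`, defined on the interval `I` (of any kind), is a geodesic of the Riemannian metric `g` on
the open set `M`: it stays in `M` and satisfies the geodesic equation `∇_γ' γ' = 0`, here paired
through `g` with an arbitrary vector `w`. At an endpoint of `I` that belongs to `I`, derivatives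
are one-sided. -/
def IsGeodesicOn (g : E → E →ₗ[ℝ] E →ₗ[ℝ] ℝ) (M : Set E) (γ : ℝ → E) (I : Set ℝ) : Prop :=
  I.OrdConnected ∧ Set.MapsTo γ I M ∧
    ∃ γ' γ'' : ℝ → E, ∀ t ∈ I,
      HasDerivWithinAt γ (γ' t) I t ∧
      HasDerivWithinAt γ' (γ'' t) I t ∧
      ∀ w : E, g (γ t) (γ'' t) w + christoffelFirst g (γ t) (γ' t) (γ' t) w = 0

/-- The condition metric `α ⟨·, ·⟩`. -/
noncomputable def conditionMetric (α : E → ℝ) (x : E) : E →ₗ[ℝ] E →ₗ[ℝ] ℝ :=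
  α x • innerₗ E

/-- Self-convexity of `α` on the open set `M` with the metric of `E`: `α` is a positive function of
class `C²` on `M`, and `log ∘ α` is convex along every geodesic of `M` for the metric
`α ⟨·, ·⟩`. -/
structure IsSelfConvexOn (α : E → ℝ) (M : Set E) : Prop where
  isOpen : IsOpen M
  contDiffOn : ContDiffOn ℝ 2 α M
  pos : ∀ x ∈ M, 0 < α x
  convexOn_log : ∀ (γ : ℝ → E) (I : Set ℝ), IsGeodesicOn (conditionMetric α) M γ I →
    ConvexOn ℝ I (fun t => Real.log (α (γ t)))

end Riemannian

/-! Let `K` be the nearest point map, h = d(·, N)² and n = x - K x, so that h has gradient 2n.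
Pairing the geodesic equation of h⁻¹⟨·,·⟩ with n gives ⟨n, γ''⟩ = 2⟨n, γ'⟩²/h - ‖γ'‖². In (-log h ∘
γ)'' every term then cancels except 2⟨DK γ', γ'⟩/h, which is nonnegative because `K` is monotone
(`inner_fderiv_closestPoint_nonneg`, `convexOn_log_geodesic`).

The work lies in showing that `K` is C¹ off N. Continuity of `K` makes h differentiable, and the
distance then grows at unit rate in some direction. Hence x lies strictly between `K x` and another
point with the same nearest point (`exists_quadratic_growth`). This makes `K x` a nondegenerate
minimizer, and the implicit function theorem applies in a chart (`contDiffAt_closestPoint`). -/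

open Filter Topology Metric

/-! ### Closest points and distance to a set. -/

section Metric

variable {E : Type*} [PseudoMetricSpace E] {N : Set E} {x y : E}

theorem IsClosestPoint.infDist_eq (h : IsClosestPoint N x y) : infDist x N = dist x y :=
  le_antisymm (infDist_le_dist_of_mem h.1) ((le_infDist ⟨y, h.1⟩).2 fun {z} hz => h.2 z hz)

theorem isClosestPoint_of_dist_le_infDist (hy : y ∈ N) (h : dist x y ≤ infDist x N) :
    IsClosestPoint N x y :=
  ⟨hy, fun _ hz => h.trans (infDist_le_dist_of_mem hz)⟩

end Metric

/-! ### Continuity and monotonicity of the nearest point map. -/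

section Inner

variable {E : Type*} [NormedAddCommGroup E] [InnerProductSpace ℝ E]

theorem norm_sq_convexCombination_sub (x b y : E) (t : ℝ) :
    ‖(1 - t) • x + t • b - y‖ ^ 2
      = (1 - t) * ‖x - y‖ ^ 2 + t * ‖b - y‖ ^ 2 - t * (1 - t) * ‖x - b‖ ^ 2 := by
  have h1 : (1 - t) • x + t • b - y = (1 - t) • (x - y) + t • (b - y) := by module
  have h2 : x - b = (x - y) - (b - y) := by abel
  rw [h1, h2, norm_add_sq_real, norm_sub_sq_real (x - y), norm_smul, norm_smul, inner_smul_left,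
    inner_smul_right, mul_pow, mul_pow, Real.norm_eq_abs, Real.norm_eq_abs, sq_abs, sq_abs]
  simp only [conj_trivial]
  ring

variable {N : Set E}

/-- A nearest point of the closure of `N` to a point of the region is already a point of `N`. -/
theorem mem_of_mem_closure_of_dist_eq_infDist {x b : E} (hx : x ∈ uniqueClosestRegion N)
    (hb : b ∈ closure N) (h : dist x b = infDist x N) : b ∈ N := by
  have hcont : Tendsto (fun t : ℝ => (1 - t) • x + t • b) (𝓝[>] 0) (𝓝 x) := by
    have : Continuous (fun t : ℝ => (1 - t) • x + t • b) := by fun_prop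
    simpa using (this.tendsto 0).mono_left nhdsWithin_le_nhds
  -- Moving x slightly towards b stays in the region. The identity above, applied to a nearest point
  -- y of the moved point, forces t‖b - y‖² ≤ 0, so b = y.
  obtain ⟨t, ht, ht1, ht0⟩ := ((hcont.eventually (mem_interior_iff_mem_nhds.1 hx)).and
    ((eventually_nhdsWithin_of_eventually_nhds (eventually_lt_nhds one_pos)).and
      self_mem_nhdsWithin)).exists
  obtain ⟨y, hy, -⟩ := ht
  have ht0 : 0 < t := ht0
  set x' := (1 - t) • x + t • b with hx'
  have h1 : dist x' y ≤ dist x' b := by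
    rw [← hy.infDist_eq, ← infDist_closure]
    exact infDist_le_dist_of_mem hb
  have h2 : dist x b ≤ dist x y := h.trans_le (infDist_le_dist_of_mem hy.1)
  have h3 : dist x' b = (1 - t) * dist x b := by
    rw [dist_eq_norm, dist_eq_norm, show x' - b = (1 - t) • (x - b) by rw [hx']; module, norm_smul,
      Real.norm_of_nonneg (by linarith)]
  have h4 := norm_sq_convexCombination_sub x b y t
  rw [← hx', ← dist_eq_norm, ← dist_eq_norm, ← dist_eq_norm, ← dist_eq_norm] at h4
  have h5 : dist x' y ^ 2 ≤ ((1 - t) * dist x b) ^ 2 := by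
    rw [← h3]; gcongr
  have h6 : dist x b ^ 2 ≤ dist x y ^ 2 := by gcongr
  have h7 : t * dist b y ^ 2 ≤ 0 := by nlinarith
  have h8 : dist b y ^ 2 ≤ 0 := by
    by_contra! hlt
    nlinarith [mul_pos ht0 hlt]
  have h9 : dist b y = 0 := by nlinarith [dist_nonneg (x := b) (y := y)]
  rw [dist_eq_zero.1 h9]
  exact hy.1

/-- N need not be closed, so this is what makes the domain open. -/
theorem uniqueClosestRegion_diff_eq :
    uniqueClosestRegion N \ N = uniqueClosestRegion N \ closure N := by
  ext x
  refine and_congr_right fun hx => not_congr ⟨fun h => subset_closure h, fun h => ?_⟩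
  refine mem_of_mem_closure_of_dist_eq_infDist hx h ?_
  rw [dist_self, ← infDist_closure, infDist_zero_of_mem h]

theorem isOpen_uniqueClosestRegion_diff : IsOpen (uniqueClosestRegion N \ N) := by
  rw [uniqueClosestRegion_diff_eq]
  exact isOpen_interior.sdiff isClosed_closure

/-- Compactness: values of `K` near x stay bounded, and any cluster point is a nearest point of the
closure, hence lies in N and equals `K x` by uniqueness. -/
theorem continuousAt_closestPoint [ProperSpace E] {K : E → E}
    (hK : ∀ x ∈ uniqueClosestRegion N, IsClosestPoint N x (K x)) {x : E}
    (hx : x ∈ uniqueClosestRegion N) : ContinuousAt K x := by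
  have hU : ∀ᶠ z in 𝓝 x, z ∈ uniqueClosestRegion N := isOpen_interior.mem_nhds hx
  have hbound : ∀ z ∈ uniqueClosestRegion N, dist x (K z) ≤ infDist x N + 2 * dist x z := by
    intro z hz
    have h1 := infDist_le_infDist_add_dist (s := N) (x := z) (y := x)
    have h2 := (hK z hz).infDist_eq
    have h3 := dist_triangle x z (K z)
    rw [dist_comm z x] at h1
    linarith
  refine (isCompact_closedBall x (infDist x N + 2)).tendsto_nhds_of_unique_mapClusterPt ?_ ?_
  · filter_upwards [hU, ball_mem_nhds x one_pos] with z hz hz1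
    have := hbound z hz
    rw [mem_ball'] at hz1
    rw [mem_closedBall']
    linarith
  · intro b _ hb
    have key : ∀ ε > 0, ∃ z ∈ uniqueClosestRegion N, dist x z < ε ∧ dist (K z) b < ε := by
      intro ε hε
      obtain ⟨z, hz1, hz2, hz3⟩ :=
        ((hb.frequently (ball_mem_nhds b hε)).and_eventually
          (hU.and (ball_mem_nhds x hε))).exists
      exact ⟨z, hz2, mem_ball'.1 hz3, hz1⟩
    have hbcl : b ∈ closure N := by
      rw [Metric.mem_closure_iff]
      intro ε hε
      obtain ⟨z, hz, -, hz2⟩ := key ε hε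
      exact ⟨K z, (hK z hz).1, by rwa [dist_comm]⟩
    have hle : dist x b ≤ infDist x N := by
      refine le_of_forall_pos_le_add fun ε hε => ?_
      obtain ⟨z, hz, hz1, hz2⟩ := key (ε / 3) (by positivity)
      have := hbound z hz
      have := dist_triangle x (K z) b
      linarith
    have hge : infDist x N ≤ dist x b := by
      rw [← infDist_closure]; exact infDist_le_dist_of_mem hbcl
    have hbN := mem_of_mem_closure_of_dist_eq_infDist hx hbcl (le_antisymm hle hge)
    exact (interior_subset hx).unique (isClosestPoint_of_dist_le_infDist hbN hle) (hK x hx)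

/-- The squared distance to `N` is differentiable where the nearest point map is continuous. -/
theorem hasFDerivAt_infDist_sq {K : E → E} {x : E} (hK : ∀ᶠ z in 𝓝 x, IsClosestPoint N z (K z))
    (hc : ContinuousAt K x) :
    HasFDerivAt (fun z => infDist z N ^ 2) (2 • innerSL ℝ (x - K x)) x := by
  refine HasFDerivAt.of_isLittleO (Asymptotics.isLittleO_iff.2 fun c hcpos => ?_)
  -- Testing `K x` against z and `K z` against x bounds the first-order remainder above by ‖z - x‖²
  -- and below by ‖z - x‖² - 2‖K z - K x‖‖z - x‖.
  have hlim : Tendsto (fun z => ‖z - x‖ + 2 * ‖K z - K x‖) (𝓝 x) (𝓝 0) := by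
    have h : ContinuousAt (fun z => ‖z - x‖ + 2 * ‖K z - K x‖) x := by fun_prop
    simpa [ContinuousAt] using h
  filter_upwards [hK, hlim.eventually (eventually_le_nhds hcpos)] with z hz hzc
  have hx := hK.self_of_nhds
  rw [hz.infDist_eq, hx.infDist_eq]
  have h1 := hz.2 _ hx.1
  have h2 := hx.2 _ hz.1
  simp only [dist_eq_norm] at h1 h2 ⊢
  have e1 : ‖z - K x‖ ^ 2 = ‖x - K x‖ ^ 2 + 2 * inner ℝ (x - K x) (z - x) + ‖z - x‖ ^ 2 := by
    rw [← norm_add_sq_real]; congr 2; abel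
  have e2 : ‖z - K z‖ ^ 2 = ‖x - K z‖ ^ 2 + 2 * inner ℝ (x - K z) (z - x) + ‖z - x‖ ^ 2 := by
    rw [← norm_add_sq_real]; congr 2; abel
  have e3 : inner ℝ (x - K z) (z - x) = inner ℝ (x - K x) (z - x) - inner ℝ (K z - K x) (z - x) := by
    rw [← inner_sub_left]; congr 1; abel
  have h3 := real_inner_le_norm (K z - K x) (z - x)
  have h1' : ‖z - K z‖ ^ 2 ≤ ‖z - K x‖ ^ 2 := by gcongr
  have h2' : ‖x - K x‖ ^ 2 ≤ ‖x - K z‖ ^ 2 := by gcongr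
  have h4 : (2 • innerSL ℝ (x - K x)) (z - x) = 2 * inner ℝ (x - K x) (z - x) := by
    simp [two_smul, two_mul, inner_sub_left]
  rw [h4, Real.norm_eq_abs]
  have h5 := mul_le_mul_of_nonneg_right hzc (norm_nonneg (z - x))
  have h6 : 0 ≤ ‖K z - K x‖ * ‖z - x‖ := by positivity
  have h7 := sq_nonneg ‖z - x‖
  rw [abs_le]
  constructor <;> nlinarith

/-- The nearest point map is monotone. -/
theorem IsClosestPoint.inner_sub_nonneg {x y p q : E} (hx : IsClosestPoint N x p)
    (hy : IsClosestPoint N y q) : 0 ≤ inner ℝ (p - q) (x - y) := by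
  have h1 := hx.2 _ hy.1
  have h2 := hy.2 _ hx.1
  simp only [dist_eq_norm] at h1 h2
  have h1' : ‖x - p‖ ^ 2 ≤ ‖x - q‖ ^ 2 := by gcongr
  have h2' : ‖y - q‖ ^ 2 ≤ ‖y - p‖ ^ 2 := by gcongr
  simp only [norm_sub_sq_real] at h1' h2'
  simp only [inner_sub_left, inner_sub_right]
  rw [real_inner_comm x p, real_inner_comm x q, real_inner_comm y p, real_inner_comm y q]
  linarith

theorem inner_fderiv_closestPoint_nonneg {K : E → E} {x : E} {A : E →L[ℝ] E}
    (hK : ∀ᶠ z in 𝓝 x, IsClosestPoint N z (K z)) (hA : HasFDerivAt K A x) (u : E) :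
    0 ≤ inner ℝ (A u) u := by
  have hl : HasDerivAt (fun t : ℝ => inner ℝ (K (x + t • u)) u) (inner ℝ (A u) u) 0 := by
    have h1 : HasDerivAt (fun t : ℝ => x + t • u) u 0 := by
      simpa using ((hasDerivAt_id (0 : ℝ)).smul_const u).const_add x
    have h2 : HasDerivAt (fun t : ℝ => K (x + t • u)) (A u) 0 := by
      refine HasFDerivAt.comp_hasDerivAt 0 (l := K) ?_ h1
      simpa using hA
    simpa using h2.inner ℝ (hasDerivAt_const (0 : ℝ) u)
  have hs := (hasDerivAt_iff_tendsto_slope.1 hl).mono_left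
    (nhdsWithin_mono 0 (fun t (ht : 0 < t) => ht.ne') : 𝓝[>] (0 : ℝ) ≤ _)
  refine ge_of_tendsto hs ?_
  have hcont : Tendsto (fun t : ℝ => x + t • u) (𝓝[>] 0) (𝓝 x) := by
    have : Continuous (fun t : ℝ => x + t • u) := by fun_prop
    simpa using (this.tendsto 0).mono_left nhdsWithin_le_nhds
  filter_upwards [hcont.eventually hK, self_mem_nhdsWithin] with t ht (ht0 : 0 < t)
  have h := ht.inner_sub_nonneg hK.self_of_nhds
  rw [add_sub_cancel_left, inner_smul_right] at h
  have h' := nonneg_of_mul_nonneg_right h ht0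
  rw [slope_def_field, sub_zero, zero_smul, add_zero, ← inner_sub_left]
  positivity

end Inner

/-! ### Growth of the distance away from N. -/

section Growth

variable {E : Type*} [NormedAddCommGroup E] [InnerProductSpace ℝ E] {N : Set E}

theorem hasDerivAt_infDist_ray {K : E → E} {x : E} (hK : ∀ᶠ z in 𝓝 x, IsClosestPoint N z (K z))
    (hc : ContinuousAt K x) (hx : x ≠ K x) :
    HasDerivAt (fun t : ℝ => infDist (x + t • (x - K x)) N) ‖x - K x‖ 0 := by
  have hpos : 0 < ‖x - K x‖ := norm_pos_iff.2 (sub_ne_zero.2 hx)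
  have h0 : infDist x N = ‖x - K x‖ := by rw [hK.self_of_nhds.infDist_eq, dist_eq_norm]
  have h1 : HasDerivAt (fun t : ℝ => x + t • (x - K x)) (x - K x) 0 := by
    simpa using ((hasDerivAt_id (0 : ℝ)).smul_const (x - K x)).const_add x
  have h2 : HasDerivAt (fun t : ℝ => infDist (x + t • (x - K x)) N ^ 2) (2 * ‖x - K x‖ ^ 2) 0 := by
    have h := HasFDerivAt.comp_hasDerivAt 0 (l := fun z => infDist z N ^ 2)
      (l' := 2 • innerSL ℝ (x - K x)) (by simpa using hasFDerivAt_infDist_sq hK hc) h1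
    have e : (2 • innerSL ℝ (x - K x)) (x - K x) = 2 * ‖x - K x‖ ^ 2 := by
      rw [← real_inner_self_eq_norm_sq, two_mul, two_smul]
      rfl
    rw [e] at h
    exact h
  have h3 := h2.sqrt (by simp [h0, hpos.ne'])
  simp only [Real.sqrt_sq infDist_nonneg, zero_smul, add_zero, h0, Real.sqrt_sq hpos.le] at h3
  convert h3 using 1
  field_simp

/-- The distance to `N` increases at unit rate in some direction, away from `N`. -/
theorem exists_infDist_eq_add [ProperSpace E] {K : E → E} {x : E} {ε : ℝ} (hε : 0 ≤ ε)
    (hK : ∀ y ∈ closedBall x ε, ∀ᶠ z in 𝓝 y, IsClosestPoint N z (K z))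
    (hc : ∀ y ∈ closedBall x ε, ContinuousAt K y) (hN : ∀ y ∈ closedBall x ε, y ∉ N) :
    ∃ x' ∈ closedBall x ε, infDist x N + ε ≤ infDist x' N := by
  -- Maximize the distance to N minus c times the distance to x. At an interior maximum, moving away
  -- from the nearest point would still gain at rate at least (1 - c)‖y - K y‖ > 0, so the maximum
  -- lies on the sphere.
  have key : ∀ c, 0 ≤ c → c < 1 → ∃ y ∈ closedBall x ε, infDist x N + c * ε ≤ infDist y N := by
    intro c hc0 hc1
    obtain ⟨y, hy, hmax⟩ := (isCompact_closedBall x ε).exists_isMaxOn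
      (f := fun y => infDist y N - c * dist y x) ⟨x, mem_closedBall_self hε⟩
      ((continuous_infDist_pt N).sub (by fun_prop)).continuousOn
    refine ⟨y, hy, ?_⟩
    have hyx := hmax (mem_closedBall_self hε)
    simp only [Set.mem_ofPred_eq, dist_self, mul_zero, sub_zero] at hyx
    rcases (mem_closedBall.1 hy).eq_or_lt with heq | hlt
    · rw [heq] at hyx
      linarith
    · exfalso
      have hyN : y ≠ K y := fun h => hN y hy (h ▸ (hK y hy).self_of_nhds.1)
      have hpos : 0 < ‖y - K y‖ := norm_pos_iff.2 (sub_ne_zero.2 hyN)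
      have hd := (hasDerivAt_infDist_ray (hK y hy) (hc y hy) hyN).sub
        ((hasDerivAt_id (0 : ℝ)).mul_const (c * ‖y - K y‖))
      have hs := (hasDerivAt_iff_tendsto_slope.1 hd).mono_left
        (nhdsWithin_mono 0 (fun t (ht : 0 < t) => ht.ne') : 𝓝[>] (0 : ℝ) ≤ _)
      have hcont : Tendsto (fun t : ℝ => y + t • (y - K y)) (𝓝[>] 0) (𝓝 y) := by
        have : Continuous (fun t : ℝ => y + t • (y - K y)) := by fun_prop
        simpa using (this.tendsto 0).mono_left nhdsWithin_le_nhds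
      obtain ⟨t, hts, htb, ht0⟩ := ((hs.eventually (lt_mem_nhds
        (show 0 < ‖y - K y‖ - 1 * (c * ‖y - K y‖) by nlinarith))).and
        ((hcont.eventually (isOpen_ball.mem_nhds (mem_ball.2 hlt))).and
          self_mem_nhdsWithin)).exists
      have ht0 : 0 < t := ht0
      have hm := hmax (ball_subset_closedBall htb)
      simp only [Set.mem_ofPred_eq] at hm
      have htri : dist (y + t • (y - K y)) x ≤ t * ‖y - K y‖ + dist y x := by
        refine (dist_triangle _ y _).trans_eq ?_
        rw [dist_eq_norm (y + _), add_sub_cancel_left, norm_smul, Real.norm_of_nonneg ht0.le]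
      have htri := mul_le_mul_of_nonneg_left htri hc0
      rw [slope_def_field, sub_zero, div_pos_iff_of_pos_right ht0] at hts
      simp at hts
      nlinarith
  obtain ⟨x', hx', hmax⟩ := (isCompact_closedBall x ε).exists_isMaxOn
    (f := fun y => infDist y N) ⟨x, mem_closedBall_self hε⟩ (continuous_infDist_pt N).continuousOn
  refine ⟨x', hx', ?_⟩
  have hlim : Tendsto (fun c : ℝ => infDist x N + c * ε) (𝓝[<] 1) (𝓝 (infDist x N + ε)) := by
    have : Continuous (fun c : ℝ => infDist x N + c * ε) := by fun_prop
    simpa using (this.tendsto 1).mono_left nhdsWithin_le_nhds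
  refine le_of_tendsto hlim ?_
  filter_upwards [self_mem_nhdsWithin,
    eventually_nhdsWithin_of_eventually_nhds (eventually_ge_nhds (one_pos (α := ℝ)))]
    with c (hc1 : c < 1) hc0
  obtain ⟨y, hy, hle⟩ := key c hc0 hc1
  exact hle.trans (hmax hy)

/-- The squared distance to a point off `N` grows quadratically away from the nearest point. -/
theorem exists_quadratic_growth [ProperSpace E] {K : E → E} {M : Set E} (hM : IsOpen M)
    (hMN : Disjoint M N) (hK : ∀ x ∈ M, IsClosestPoint N x (K x)) (hc : ∀ x ∈ M, ContinuousAt K x)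
    {x : E} (hx : x ∈ M) :
    ∃ c > 0, ∀ z ∈ N, ‖x - K x‖ ^ 2 + c * ‖K x - z‖ ^ 2 ≤ ‖x - z‖ ^ 2 := by
  obtain ⟨ε, hε, hball⟩ := nhds_basis_closedBall.mem_iff.1 (hM.mem_nhds hx)
  obtain ⟨x', hx', hle⟩ := exists_infDist_eq_add hε.le
    (fun y hy => Filter.mem_of_superset (hM.mem_nhds (hball hy)) hK)
    (fun y hy => hc y (hball hy)) (fun y hy => hMN.notMem_of_mem_left (hball hy))
  have hp := hK x hx
  rw [hp.infDist_eq] at hle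
  rw [mem_closedBall] at hx'
  -- The triangle inequality leaves no slack: `K x` is also nearest to x', and x lies on the segment
  -- between them.
  have hp' : IsClosestPoint N x' (K x) := by
    refine isClosestPoint_of_dist_le_infDist hp.1 (le_trans ?_ hle)
    linarith [dist_triangle x' x (K x)]
  rw [hp'.infDist_eq] at hle
  have hbtw : Wbtw ℝ (K x) x x' := by
    rw [← dist_add_dist_eq_iff]
    refine le_antisymm ?_ (dist_triangle _ _ _)
    rw [dist_comm (K x) x, dist_comm x x', dist_comm (K x) x']
    linarith
  obtain ⟨s, ⟨hs0, hs1⟩, hs⟩ := hbtw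
  have hs1 : s < 1 := by
    refine lt_of_le_of_ne hs1 fun h => ?_
    rw [h, AffineMap.lineMap_apply_one] at hs
    rw [hs] at hle
    linarith
  rw [AffineMap.lineMap_apply_module] at hs
  refine ⟨1 - s, by linarith, fun z hz => ?_⟩
  have h1 := norm_sq_convexCombination_sub (K x) x' z s
  have h2 := norm_sq_convexCombination_sub (K x) x' (K x) s
  rw [hs] at h1 h2
  have h3 := hp'.2 z hz
  simp only [dist_eq_norm] at h3
  have h3' : ‖x' - K x‖ ^ 2 ≤ ‖x' - z‖ ^ 2 := by gcongr
  rw [h1, h2, sub_self, norm_zero]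
  nlinarith

end Growth

/-! ### Smooth dependence of nondegenerate minimizers. -/

section ImplicitMinimizer

/-- If m < 0, the point is also a local maximum, so f is locally constant and m = 0. -/
theorem IsLocalMin.secondDeriv_nonneg {f f' : ℝ → ℝ} {m t : ℝ} (hmin : IsLocalMin f t)
    (hf : ∀ᶠ s in 𝓝 t, HasDerivAt f (f' s) s) (hf' : HasDerivAt f' m t) : 0 ≤ m := by
  by_contra! hm
  have hd : deriv f =ᶠ[𝓝 t] f' := hf.mono fun s hs => hs.deriv
  have hmax : IsLocalMax f t := isLocalMax_of_deriv_deriv_neg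
    (by rwa [hd.deriv_eq, hf'.deriv]) hmin.deriv_eq_zero hf.self_of_nhds.continuousAt
  have hconst : f =ᶠ[𝓝 t] fun _ => f t := by
    filter_upwards [hmin, hmax] with s h1 h2 using le_antisymm h2 h1
  have hzero : f' =ᶠ[𝓝 t] fun _ => 0 := by
    filter_upwards [hf, hconst.eventuallyEq_nhds] with s h1 h2
    exact h1.unique ((hasDerivAt_const s (f t)).congr_of_eventuallyEq h2)
  exact hm.ne (hf'.unique ((hasDerivAt_const t (0 : ℝ)).congr_of_eventuallyEq hzero))

variable {E : Type*} [NormedAddCommGroup E] [InnerProductSpace ℝ E] [CompleteSpace E]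
  {V : Type*} [NormedAddCommGroup V] [NormedSpace ℝ V] [FiniteDimensional ℝ V]

/-- A continuous choice of local minimizers of the distance to a `C²` parametrized set is `C¹` at a
point where the minimum is nondegenerate. -/
theorem contDiffAt_of_isLocalMin_norm_sub_sq {φ : V → E} {w : E → V} {x₀ : E} {c : ℝ} (hc : 0 < c)
    (hφ : ContDiffAt ℝ 2 φ (w x₀)) (hw : ContinuousAt w x₀)
    (hgrow : ∀ᶠ v in 𝓝 (w x₀),
      ‖x₀ - φ (w x₀)‖ ^ 2 + c * ‖v - w x₀‖ ^ 2 ≤ ‖x₀ - φ v‖ ^ 2)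
    (hmin : ∀ᶠ x in 𝓝 x₀, IsLocalMin (fun v => ‖x - φ v‖ ^ 2) (w x)) :
    ContDiffAt ℝ 1 w x₀ := by
  have : CompleteSpace V := FiniteDimensional.complete ℝ V
  set v₀ := w x₀ with hv₀
  -- Half the derivative in v of ‖x - φ v‖²; the implicit function theorem is applied to F = 0.
  let F : E × V → (V →L[ℝ] ℝ) := fun q => (innerSL ℝ (φ q.2 - q.1)).comp (fderiv ℝ φ q.2)
  have hdiff : ∀ᶠ v in 𝓝 v₀, DifferentiableAt ℝ φ v :=
    (hφ.eventually (by simp)).mono fun v hv => hv.differentiableAt (by simp)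
  have hψ : ∀ x v, DifferentiableAt ℝ φ v →
      HasFDerivAt (fun v => ‖x - φ v‖ ^ 2) ((2 : ℝ) • F (x, v)) v := by
    intro x v hv
    have h := (hv.hasFDerivAt.const_sub x).norm_sq
    convert h using 1
    ext a
    simp [F]
  have hF : ContDiffAt ℝ 1 F (x₀, v₀) := by
    have h1 : ContDiffAt ℝ 1 (fun q : E × V => fderiv ℝ φ q.2) (x₀, v₀) :=
      ContDiffAt.comp (x₀, v₀) (g := fderiv ℝ φ) (f := Prod.snd)
        (hφ.fderiv_right (by norm_num)) contDiffAt_snd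
    have h2 : ContDiffAt ℝ 1 (fun q : E × V => φ q.2 - q.1) (x₀, v₀) :=
      (ContDiffAt.comp (x₀, v₀) (g := φ) (f := Prod.snd)
        (hφ.of_le (by norm_num)) contDiffAt_snd).sub contDiffAt_fst
    exact ((innerSL ℝ).contDiff.contDiffAt.comp (x₀, v₀) h2).clm_comp h1
  have hF0 : ∀ᶠ x in 𝓝 x₀, F (x, w x) = 0 := by
    filter_upwards [hmin, hw.eventually hdiff] with x hx hd
    have := hx.hasFDerivAt_eq_zero (hψ x _ hd)
    simpa using this
  set A : V →L[ℝ] V →L[ℝ] ℝ := fderiv ℝ F (x₀, v₀) ∘L .inr ℝ E V with hA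
  -- By the growth hypothesis, subtracting c t²‖a‖² along the line leaves a local minimum at t = 0,
  -- so its second derivative is nonnegative.
  have hApos : ∀ a, c * ‖a‖ ^ 2 ≤ A a a := by
    intro a
    have hline : HasDerivAt (fun t : ℝ => v₀ + t • a) a 0 := by
      simpa using ((hasDerivAt_id (0 : ℝ)).smul_const a).const_add v₀
    have hlim : Tendsto (fun t : ℝ => v₀ + t • a) (𝓝 0) (𝓝 v₀) := by
      simpa using hline.continuousAt.tendsto
    have hA' : HasDerivAt (fun t : ℝ => F (x₀, v₀ + t • a)) (A a) 0 := by
      have h1 : HasDerivAt (fun t : ℝ => (x₀, v₀ + t • a)) ((0 : E), a) 0 :=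
        (hasDerivAt_const (0 : ℝ) x₀).prodMk hline
      refine HasFDerivAt.comp_hasDerivAt 0 (l := F) (l' := fderiv ℝ F (x₀, v₀)) ?_ h1
      simpa using (hF.differentiableAt (by simp)).hasFDerivAt
    have hA'' : HasDerivAt (fun t : ℝ => 2 * F (x₀, v₀ + t • a) a - c * (2 * t * ‖a‖ ^ 2))
        (2 * A a a - c * (2 * ‖a‖ ^ 2)) 0 := by
      have h1 := (hA'.clm_apply (hasDerivAt_const (0 : ℝ) a)).const_mul 2
      have h2 : HasDerivAt (fun t : ℝ => c * (2 * t * ‖a‖ ^ 2)) (c * (2 * ‖a‖ ^ 2)) 0 := by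
        simpa using (((hasDerivAt_id (0 : ℝ)).const_mul 2).mul_const (‖a‖ ^ 2)).const_mul c
      have h3 := h1.sub h2
      simp only [map_zero, add_zero] at h3
      exact h3
    have hder : ∀ᶠ t in 𝓝 (0 : ℝ), HasDerivAt
        (fun t : ℝ => ‖x₀ - φ (v₀ + t • a)‖ ^ 2 - c * (t ^ 2 * ‖a‖ ^ 2))
        (2 * F (x₀, v₀ + t • a) a - c * (2 * t * ‖a‖ ^ 2)) t := by
      filter_upwards [hlim.eventually hdiff] with t ht
      have hl : HasDerivAt (fun t : ℝ => v₀ + t • a) a t := by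
        simpa using ((hasDerivAt_id t).smul_const a).const_add v₀
      have h1 := (hψ x₀ _ ht).comp_hasDerivAt t hl
      have h2 : HasDerivAt (fun t : ℝ => c * (t ^ 2 * ‖a‖ ^ 2)) (c * (2 * t * ‖a‖ ^ 2)) t := by
        simpa using ((hasDerivAt_pow 2 t).mul_const (‖a‖ ^ 2)).const_mul c
      exact h1.sub h2
    have hloc : IsLocalMin
        (fun t : ℝ => ‖x₀ - φ (v₀ + t • a)‖ ^ 2 - c * (t ^ 2 * ‖a‖ ^ 2)) 0 := by
      filter_upwards [hlim.eventually hgrow] with t ht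
      simp only [add_sub_cancel_left, norm_smul, mul_pow, Real.norm_eq_abs, sq_abs] at ht
      simp
      linarith
    have := hloc.secondDeriv_nonneg hder hA''
    linarith
  have hAinj : Function.Injective A := by
    rw [injective_iff_map_eq_zero]
    intro a ha
    have h := hApos a
    rw [ha, zero_apply] at h
    by_contra hne
    have : 0 < ‖a‖ := norm_pos_iff.2 hne
    nlinarith [mul_pos hc (pow_pos this 2)]
  have hAinv : A.IsInvertible := by
    have hfin : Module.finrank ℝ V = Module.finrank ℝ (V →L[ℝ] ℝ) := by
      rw [← (LinearMap.toContinuousLinearMap (𝕜 := ℝ) (E := V) (F' := ℝ)).finrank_eq]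
      exact (Subspace.dual_finrank_eq (K := ℝ) (V := V)).symm
    exact ⟨(LinearEquiv.ofInjectiveOfFinrankEq A.toLinearMap hAinj hfin).toContinuousLinearEquiv,
      by ext; rfl⟩
  have hpair : Tendsto (fun x => (x, w x)) (𝓝 x₀) (𝓝 (x₀, v₀)) :=
    (continuousAt_id.prodMk hw : ContinuousAt (fun x => (x, w x)) x₀)
  have hev : hF.implicitFunction one_ne_zero hAinv =ᶠ[𝓝 x₀] w := by
    filter_upwards [hpair.eventually (hF.eventually_apply_eq_iff_implicitFunction one_ne_zero hAinv),
      hF0] with x h1 h2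
    exact h1.1 (h2.trans hF0.self_of_nhds.symm)
  exact (hF.contDiffAt_implicitFunction one_ne_zero hAinv).congr_of_eventuallyEq hev.symm

end ImplicitMinimizer

/-! ### Regularity of the nearest point map and of the squared distance. -/

section Regularity

variable {E : Type*} [NormedAddCommGroup E] [InnerProductSpace ℝ E]
  {N M : Set E} {K : E → E}

/-- The nearest point map onto a `C²` submanifold is `C¹` off the submanifold, on open sets where
it is continuous. -/
theorem contDiffAt_closestPoint [FiniteDimensional ℝ E] (hN : IsC2Submanifold N) (hM : IsOpen M)
    (hMN : Disjoint M N) (hK : ∀ x ∈ M, IsClosestPoint N x (K x)) (hc : ∀ x ∈ M, ContinuousAt K x)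
    {x₀ : E} (hx₀ : x₀ ∈ M) : ContDiffAt ℝ 1 K x₀ := by
  have : ProperSpace E := FiniteDimensional.proper ℝ E
  obtain ⟨Φ, V, hp, hΦ, hΦs, himg⟩ := hN _ (hK x₀ hx₀).1
  have hsrc : ∀ᶠ x in 𝓝 x₀, x ∈ M ∧ K x ∈ Φ.source :=
    (Filter.eventually_mem_set.2 (hM.mem_nhds hx₀)).and
      ((hc x₀ hx₀).eventually (Φ.open_source.mem_nhds hp))
  have hV : ∀ z ∈ N, z ∈ Φ.source → Φ z ∈ V := fun z hz hz' =>
    (himg.subset ⟨z, ⟨hz', hz⟩, rfl⟩).2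
  have hmem : ∀ v : V, (v : E) ∈ Φ.target → Φ.symm v ∈ N := by
    intro v hv
    obtain ⟨z, ⟨hz, hzN⟩, hzv⟩ := himg.superset ⟨hv, v.2⟩
    rwa [← hzv, Φ.left_inv hz]
  let φ : V → E := fun v => Φ.symm v
  -- The projection only serves to land in the type `V`: near x₀ the point Φ (K x) already lies in
  -- the subspace.
  let w : E → V := fun x => V.orthogonalProjectionOnto (Φ (K x))
  have hw : ∀ x ∈ M, K x ∈ Φ.source → (w x : E) = Φ (K x) := fun x hx hx' =>
    Submodule.starProjection_eq_self_iff.2 (hV _ (hK x hx).1 hx')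
  have hw₀ := hw x₀ hx₀ hp
  have hφw : ∀ x ∈ M, K x ∈ Φ.source → φ (w x) = K x := fun x hx hx' => by
    simp only [φ, hw x hx hx', Φ.left_inv hx']
  have htgt : ∀ v : V, (v : E) ∈ Φ.target → ∀ᶠ v' : V in 𝓝 v, (v' : E) ∈ Φ.target := fun v hv =>
    continuous_subtype_val.continuousAt.eventually (Φ.open_target.mem_nhds hv)
  have hwt : ∀ x ∈ M, K x ∈ Φ.source → (w x : E) ∈ Φ.target := fun x hx hx' => by
    rw [hw x hx hx']; exact Φ.map_source hx'
  have hφ : ContDiffAt ℝ 2 φ (w x₀) :=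
    ContDiffAt.comp (w x₀) (g := Φ.symm) (f := V.subtypeL)
      (hΦs.contDiffAt (Φ.open_target.mem_nhds (hwt x₀ hx₀ hp))) V.subtypeL.contDiff.contDiffAt
  have hwc : ContinuousAt w x₀ :=
    V.orthogonalProjectionOnto.continuous.continuousAt.comp
      ((Φ.continuousAt hp).comp (hc x₀ hx₀))
  obtain ⟨c, hcpos, hgrow⟩ := exists_quadratic_growth hM hMN hK hc hx₀
  obtain ⟨L, s, hs, hL⟩ := ((hΦ.contDiffAt (Φ.open_source.mem_nhds hp)).of_le
    (by norm_num : (1 : WithTop ℕ∞) ≤ 2)).exists_lipschitzOnWith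
  have hwC1 : ContDiffAt ℝ 1 w x₀ := by
    -- The Lipschitz constant L of Φ transfers the growth on N to the chart; the + 1 keeps the
    -- denominator positive.
    refine contDiffAt_of_isLocalMin_norm_sub_sq (φ := φ) (c := c / (L + 1) ^ 2) (by positivity)
      hφ hwc ?_ ?_
    · have hφs : ∀ᶠ v in 𝓝 (w x₀), φ v ∈ s := by
        refine hφ.continuousAt.eventually ?_
        rw [hφw x₀ hx₀ hp]
        exact hs
      filter_upwards [hφs, htgt _ (hwt x₀ hx₀ hp)] with v hvs hvt
      have h1 := hgrow _ (hmem v hvt)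
      have h2 := hL.dist_le_mul _ hvs _ (mem_of_mem_nhds hs)
      rw [show Φ (φ v) = v from Φ.right_inv hvt, ← hw₀, dist_eq_norm, dist_eq_norm,
        ← Submodule.coe_sub, ← Submodule.coe_norm] at h2
      rw [hφw x₀ hx₀ hp]
      refine le_trans ?_ h1
      rw [norm_sub_rev (K x₀)]
      have h3 : ‖v - w x₀‖ ^ 2 ≤ ((L + 1) * ‖φ v - K x₀‖) ^ 2 := by
        gcongr
        exact h2.trans (by gcongr; linarith)
      have h4 : c / (L + 1) ^ 2 * ‖v - w x₀‖ ^ 2 ≤ c * ‖φ v - K x₀‖ ^ 2 := by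
        calc _ ≤ c / (L + 1) ^ 2 * ((L + 1) * ‖φ v - K x₀‖) ^ 2 := by gcongr
          _ = _ := by field_simp
      exact add_le_add le_rfl h4
    · filter_upwards [hsrc] with x hx
      filter_upwards [htgt _ (hwt x hx.1 hx.2)] with v hv
      have h := (hK x hx.1).2 _ (hmem v hv)
      rw [dist_eq_norm, dist_eq_norm] at h
      rw [hφw x hx.1 hx.2]
      gcongr
  have hev : K =ᶠ[𝓝 x₀] φ ∘ w := by
    filter_upwards [hsrc] with x hx using (hφw x hx.1 hx.2).symm
  exact ((hφ.of_le (by norm_num)).comp x₀ hwC1).congr_of_eventuallyEq hev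

/-- The gradient 2(z - K z) is itself C¹. -/
theorem contDiffAt_infDist_sq (hM : IsOpen M) (hK : ∀ x ∈ M, IsClosestPoint N x (K x))
    (hKd : ∀ x ∈ M, ContDiffAt ℝ 1 K x) {x : E} (hx : x ∈ M) :
    ContDiffAt ℝ 2 (fun z => infDist z N ^ 2) x := by
  have h := contDiffAt_succ_iff_hasFDerivAt (𝕜 := ℝ) (n := 1) (x := x)
    (f := fun z => infDist z N ^ 2)
  norm_num at h
  rw [h]
  refine ⟨fun z => 2 • innerSL ℝ (z - K z), ⟨M, hM.mem_nhds hx, fun z hz => ?_⟩, ?_⟩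
  · exact hasFDerivAt_infDist_sq (mem_of_superset (hM.mem_nhds hz) hK) (hKd z hz).continuousAt
  · exact (((innerSL ℝ).contDiff.contDiffAt).comp x (contDiffAt_id.sub (hKd x hx))).const_smul 2

end Regularity

/-! ### The geodesic equation and convexity. -/

section Geodesic

variable {E : Type*} [NormedAddCommGroup E] [InnerProductSpace ℝ E]

theorem christoffelFirst_conditionMetric {α : E → ℝ} {α' : E →L[ℝ] ℝ} {x : E}
    (h : HasFDerivAt α α' x) (u v w : E) :
    christoffelFirst (conditionMetric α) x u v w
      = (α' u * inner ℝ v w + α' v * inner ℝ u w - α' w * inner ℝ u v) / 2 := by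
  have key : ∀ a b : E, fderiv ℝ (fun y => conditionMetric α y a b) x = inner ℝ a b • α' := by
    intro a b
    have : HasFDerivAt (fun y => conditionMetric α y a b) (inner ℝ a b • α') x := h.mul_const _
    exact this.fderiv
  simp only [christoffelFirst, key, smul_apply, smul_eq_mul]
  ring

/-- The geodesic equation of `h⁻¹ ⟨·, ·⟩` paired with `n`, when `h` has gradient `2 n` and value
`‖n‖²`. -/
theorem inner_eq_of_geodesic_equation {h : E → ℝ} {x n u a : E}
    (hd : HasFDerivAt h (2 • innerSL ℝ n) x) (hn : h x = ‖n‖ ^ 2) (h0 : h x ≠ 0)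
    (hgeo : conditionMetric (fun y => 1 / h y) x a n
      + christoffelFirst (conditionMetric (fun y => 1 / h y)) x u u n = 0) :
    inner ℝ n a = 2 * inner ℝ n u ^ 2 / h x - ‖u‖ ^ 2 := by
  have hα : HasFDerivAt (fun y => 1 / h y) (-(h x ^ 2)⁻¹ • (2 • innerSL ℝ n)) x := by
    have := (hasDerivAt_inv h0).comp_hasFDerivAt x hd
    simp only [one_div]
    exact this
  rw [christoffelFirst_conditionMetric hα] at hgeo
  have e1 : conditionMetric (fun y => 1 / h y) x a n = 1 / h x * inner ℝ n a := by
    simp [conditionMetric, real_inner_comm]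
  have e2 : ∀ b, (-(h x ^ 2)⁻¹ • (2 • innerSL ℝ n)) b = -(h x ^ 2)⁻¹ * (2 * inner ℝ n b) := by
    intro b
    simp [two_smul]
    ring
  rw [e1, e2, e2, real_inner_self_eq_norm_sq, real_inner_self_eq_norm_sq, ← hn,
    real_inner_comm n u] at hgeo
  field_simp at hgeo ⊢
  linarith

variable {N M : Set E} {K : E → E}

theorem convexOn_log_geodesic (hM : IsOpen M) (hMN : Disjoint M N)
    (hK : ∀ x ∈ M, IsClosestPoint N x (K x)) (hKd : ∀ x ∈ M, DifferentiableAt ℝ K x)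
    {γ : ℝ → E} {I : Set ℝ}
    (hγ : IsGeodesicOn (conditionMetric fun x => 1 / infDist x N ^ 2) M γ I) :
    ConvexOn ℝ I (fun t => Real.log (1 / infDist (γ t) N ^ 2)) := by
  obtain ⟨hI, hmaps, γ', γ'', hder⟩ := hγ
  set h : E → ℝ := fun x => infDist x N ^ 2 with hh
  have hev : ∀ x ∈ M, ∀ᶠ z in 𝓝 x, IsClosestPoint N z (K z) := fun x hx =>
    mem_of_superset (hM.mem_nhds hx) hK
  have hd : ∀ x ∈ M, HasFDerivAt h (2 • innerSL ℝ (x - K x)) x := fun x hx =>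
    hasFDerivAt_infDist_sq (hev x hx) (hKd x hx).continuousAt
  have hval : ∀ x ∈ M, h x = ‖x - K x‖ ^ 2 := fun x hx => by
    simp only [hh, (hK x hx).infDist_eq, dist_eq_norm]
  have hpos : ∀ x ∈ M, 0 < h x := by
    intro x hx
    rw [hval x hx]
    have : x ≠ K x := fun e => hMN.notMem_of_mem_left hx (e ▸ (hK x hx).1)
    have := norm_pos_iff.2 (sub_ne_zero.2 this)
    positivity
  have hlog : (fun t => Real.log (1 / infDist (γ t) N ^ 2)) = fun t => -Real.log (h (γ t)) := by
    ext t
    rw [one_div, Real.log_inv]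
  rw [hlog]
  have h1 : ∀ t ∈ I, HasDerivWithinAt (fun t => h (γ t))
      (2 * inner ℝ (γ t - K (γ t)) (γ' t)) I t := by
    intro t ht
    have := (hd _ (hmaps ht)).comp_hasDerivWithinAt t (hder t ht).1
    have e : (2 • innerSL ℝ (γ t - K (γ t))) (γ' t) = 2 * inner ℝ (γ t - K (γ t)) (γ' t) := by
      rw [two_mul, two_smul]; rfl
    rw [e] at this
    exact this
  have h2 : ∀ t ∈ I, HasDerivWithinAt (fun t => 2 * inner ℝ (γ t - K (γ t)) (γ' t))
      (2 * (inner ℝ (γ t - K (γ t)) (γ'' t)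
        + inner ℝ (γ' t - fderiv ℝ K (γ t) (γ' t)) (γ' t))) I t := by
    intro t ht
    have hk := (hKd _ (hmaps ht)).hasFDerivAt.comp_hasDerivWithinAt t (hder t ht).1
    exact (((hder t ht).1.sub hk).inner ℝ (hder t ht).2.1).const_mul 2
  have hsub := interior_subset (s := I)
  refine convexOn_of_hasDerivWithinAt2_nonneg hI.convex
    (f' := fun t => -(2 * inner ℝ (γ t - K (γ t)) (γ' t) / h (γ t)))
    (f'' := fun t => 2 * inner ℝ (fderiv ℝ K (γ t) (γ' t)) (γ' t) / h (γ t)) ?_ ?_ ?_ ?_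
  · intro t ht
    exact ((h1 t ht).log (hpos _ (hmaps ht)).ne').neg.continuousWithinAt
  · intro t ht
    exact (((h1 t (hsub ht)).log (hpos _ (hmaps (hsub ht))).ne').neg).mono hsub
  · intro t ht
    have htI := hsub ht
    have h0 := (hpos _ (hmaps htI)).ne'
    have hgeo := inner_eq_of_geodesic_equation (hd _ (hmaps htI)) (hval _ (hmaps htI)) h0
      ((hder t htI).2.2 _)
    have h3 := (((h2 t htI).div (h1 t htI) h0).neg).mono hsub
    refine h3.congr_deriv ?_
    -- Substituting for ⟨n, γ''⟩ cancels both ‖γ'‖² and ⟨n, γ'⟩².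
    rw [hgeo, inner_sub_left (γ' t), real_inner_self_eq_norm_sq]
    field_simp
    ring
  · intro t ht
    have htM := hmaps (hsub ht)
    have := inner_fderiv_closestPoint_nonneg (hev _ htM) (hKd _ htM).hasFDerivAt (γ' t)
    have := hpos _ htM
    positivity

end Geodesic

theorem theorem2 (j : ℕ) (N : Set (EuclideanSpace ℝ (Fin j))) (hN : IsC2Submanifold N) :
    IsSelfConvexOn (fun x => 1 / (Metric.infDist x N) ^ 2) (uniqueClosestRegion N \ N) := by
  classical
  let K : EuclideanSpace ℝ (Fin j) → EuclideanSpace ℝ (Fin j) := fun x =>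
    if h : ∃ y, IsClosestPoint N x y then h.choose else 0
  have hK : ∀ x ∈ uniqueClosestRegion N, IsClosestPoint N x (K x) := by
    intro x hx
    have h : ∃ y, IsClosestPoint N x y := (interior_subset hx).exists
    simp only [K, dif_pos h]
    exact h.choose_spec
  have hM : IsOpen (uniqueClosestRegion N \ N) := isOpen_uniqueClosestRegion_diff
  have hMN : Disjoint (uniqueClosestRegion N \ N) N := Set.disjoint_sdiff_left
  have hKM : ∀ x ∈ uniqueClosestRegion N \ N, IsClosestPoint N x (K x) := fun x hx => hK x hx.1
  have hKd : ∀ x ∈ uniqueClosestRegion N \ N, ContDiffAt ℝ 1 K x := fun x hx =>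
    contDiffAt_closestPoint hN hM hMN hKM (fun y hy => continuousAt_closestPoint hK hy.1) hx
  have hpos : ∀ x ∈ uniqueClosestRegion N \ N, 0 < infDist x N := by
    intro x hx
    rw [(hKM x hx).infDist_eq, dist_pos]
    exact fun e => hx.2 (e ▸ (hKM x hx).1)
  refine ⟨hM, fun x hx => ?_, fun x hx => ?_, fun γ I hγ => ?_⟩
  · have hne : infDist x N ^ 2 ≠ 0 := (pow_pos (hpos x hx) 2).ne'
    exact (contDiffAt_const.div (contDiffAt_infDist_sq hM hKM hKd hx) hne).contDiffWithinAt
  · have := hpos x hx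
    positivity
  · exact convexOn_log_geodesic hM hMN hKM (fun x hx => (hKd x hx).differentiableAt (by simp)) hγ
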